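/- There exist absolute constants $C>0$ and $k\in\mathbb N$ such that the following holds for every finite field $\mathbb F_q$ with $q$ elements. Write $\log$ for the natural logarithm, and for $f,g\ge 0$ write $f\lesssim g$ (equivalently $g\gtrsim f$) for $f\le C(\log q)^k g$. For finite $S,T\subseteq\mathbb F_q$ let $E(S,T)$ be the number of $(s_1,s_2,t_1,t_2)\in S^2\times T^2$ with $s_1+t_1=s_2+t_2$. Let $A,X\subseteq\mathbb F_q^*=\mathbb F_q\setminus\{0\}$ be non-empty and let $K>0$ be a real number such that \[ \sum_{\xi\in X}E(A,\xi A)\ \ge\ \frac{|A|^3|X|}{K}. \] Then there exist elements $\bar a\in A$ and $x_0\in X$ and subsets $A_1\subseteq A-\bar a$ and $X'\subseteq x_0^{-1}X$ such that (i) $|A_1|\gtrsim K^{-85}|A|$ and $|X'|\gtrsim K^{-5}|X|$; (ii) $|A_1+X'A_1|\lesssim K^{226}|A_1|$; (iii) $|A_1+A_1|\lesssim K^{92}|A_1|$ and $|A_1-A_1|\lesssim K^{92}|A_1|$; (iv) $|A_1+x'A_1|\lesssim K^{126}|A_1|$ and $|A_1-x'A_1|\lesssim K^{126}|A_1|$ for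 all $x'\in X'$. Moreover, if $E(A,\xi A)\ge |A|^3/K$ for all $\xi\in X$, then in addition $|X'|\gtrsim K^{-4}|X|$. -/

import Mathlib

open scoped Pointwise

/-! Large energy between `A` and `ξ • A` gives, by Balog–Szemerédi–Gowers
(`balog_szemeredi_gowers`), dense `P₁, P₂ ⊆ A`, depending on `ξ`, with `P₁ + ξ • P₂` small. All the
products `P₁ × P₂` are dense in `A × A`, so by Cauchy–Schwarz (`exists_popular_intersection`) one of
them, belonging to some `η`, meets many others in a dense set. Let `B` be the second component for
`η`. Plünnecke bounds its sums and differences. For each of these many `ξ`, Ruzsa's triangle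
inequality through the common part bounds `B ± y • B`, where `y = η⁻¹ * ξ`, and a translate of `y •
B` meets `B` in many points (`exists_subset_almost_invariant`).

It remains to make `A₁ + X' * A₁` small at once, and not only for each dilate: this is Bourgain's
lemma, `exists_subset_card_add_mul_le`. The energy of `B` with its dilates yields a translate `A₁`
of a large part of `B` such that, for `v ∈ A₁`, many `y` send `v` into one translate of `B`. Let `V`
be the set of `u` such that many differences `y - y'` carry `u`, up to a shift fixed by the pair,
into `2B - 2B`. Each pair with `y ≠ y'` admits at most `|2B - 2B|` such `u`, so `V` is small. Yet
every `u ∈ X' * A₁` has many translates `u + a` in `V` with `a ∈ B`. Writing `a₀ + u = (u + a) + (a₀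
- a)` then bounds `A₁ + X' * A₁` through `V` and `A₁ - B`.

The graph argument uses weights instead of popularity thresholds, and no dyadic pigeonholing occurs,
so no logarithm is lost. -/

/-! ### Balog–Szemerédi–Gowers theorem with weighted graphs. -/

open Finset in
/-- The part of a sum carried by terms at least half the average. -/
lemma card_mul_le_mul_card_filter_le {ι : Type*} (s : Finset ι) (f : ι → ℝ) {M c : ℝ}
    (hc : 0 ≤ c) (hf : ∀ i ∈ s, f i ≤ M) (h : (#s : ℝ) * (2 * c) ≤ ∑ i ∈ s, f i) :
    (#s : ℝ) * c ≤ M * (#{i ∈ s | c ≤ f i} : ℝ) := by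
  have h1 : ∑ i ∈ s, f i ≤ ∑ i ∈ s, (c + if c ≤ f i then M else 0) := by
    refine sum_le_sum fun i hi => ?_
    split_ifs with hi'
    · linarith [hf i hi]
    · linarith
  rw [sum_add_distrib, ← sum_filter] at h1
  simp only [sum_const, nsmul_eq_mul] at h1
  linarith

open Finset in
/-- A dense weighted bipartite graph has large parts all of whose pairs are joined by many
weighted paths of length three. -/
lemma exists_subsets_many_weighted_paths {α β : Type*} (A : Finset α) (B : Finset β)
    (w : α → β → ℝ) (hw0 : ∀ a b, 0 ≤ w a b) (hw1 : ∀ a b, w a b ≤ 1) {n K : ℝ} (hn : 0 < n)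
    (hA : (#A : ℝ) = n) (hB : (#B : ℝ) = n) (hK : 0 < K)
    (h : n ^ 2 / K ≤ ∑ a ∈ A, ∑ b ∈ B, w a b) :
    ∃ A' ⊆ A, ∃ B' ⊆ B, n / (6 * K) ≤ (#A' : ℝ) ∧ n / (4 * K) ≤ (#B' : ℝ) ∧
      ∀ a ∈ A', ∀ b ∈ B', n ^ 2 / (3072 * K ^ 5) ≤
        ∑ a' ∈ A, ∑ b' ∈ B, w a b' * w a' b' * w a' b := by
  classical
  set deg : α → ℝ := fun a => ∑ b ∈ B, w a b with hdeg
  set A₀ := {a ∈ A | n / (2 * K) ≤ deg a} with hA₀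
  set cod : α → α → ℝ := fun a a' => ∑ b ∈ B, w a b * w a' b with hcod
  -- This value makes the total penalty `16 * K * (n ^ 2 * η)` for pairs of small codegree exactly
  -- half of the lower bound for `∑ M b ^ 2`.
  set η : ℝ := n / (128 * K ^ 3) with hη
  have hη0 : 0 < η := by positivity
  have hA₀A : A₀ ⊆ A := filter_subset _ _
  have hcod0 : ∀ a a', 0 ≤ cod a a' := fun a a' =>
    sum_nonneg fun b _ => mul_nonneg (hw0 _ _) (hw0 _ _)
  have hdegA₀ : n ^ 2 / (2 * K) ≤ ∑ a ∈ A₀, deg a := by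
    have h1 : ∑ a ∈ A, deg a ≤ ∑ a ∈ A, (n / (2 * K) + if n / (2 * K) ≤ deg a then deg a else 0) := by
      refine sum_le_sum fun a _ => ?_
      split_ifs with ha
      · have : 0 < n / (2 * K) := by positivity
        linarith
      · linarith
    rw [sum_add_distrib, ← sum_filter] at h1
    simp only [sum_const, nsmul_eq_mul, hA] at h1
    have h2 : n ^ 2 / K = n * (n / (2 * K)) + n ^ 2 / (2 * K) := by field_simp; ring
    linarith
  set M : β → ℝ := fun b => ∑ a ∈ A₀, w a b with hM
  set Bd : β → ℝ := fun b => ∑ a ∈ A₀, ∑ a' ∈ A₀, if cod a a' < η then w a b * w a' b else 0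
    with hBd
  have hMsum : n ^ 2 / (2 * K) ≤ ∑ b ∈ B, M b := by
    rw [hM, sum_comm]; exact hdegA₀
  have hMsq : n ^ 3 / (4 * K ^ 2) ≤ ∑ b ∈ B, M b ^ 2 := by
    have h1 := sq_sum_le_card_mul_sum_sq (s := B) (f := M)
    rw [hB] at h1
    have h2 : (n ^ 2 / (2 * K)) ^ 2 ≤ (∑ b ∈ B, M b) ^ 2 :=
      pow_le_pow_left₀ (by positivity) hMsum 2
    have h3 : (n ^ 2 / (2 * K)) ^ 2 = n * (n ^ 3 / (4 * K ^ 2)) := by field_simp; ring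
    rw [h3] at h2
    exact le_of_mul_le_mul_left (h2.trans h1) hn
  have hBdsum : ∑ b ∈ B, Bd b ≤ n ^ 2 * η := by
    have hA₀n : (#A₀ : ℝ) ≤ n := by rw [← hA]; exact_mod_cast card_le_card hA₀A
    calc ∑ b ∈ B, Bd b = ∑ a ∈ A₀, ∑ a' ∈ A₀, if cod a a' < η then cod a a' else 0 := by
          rw [hBd, sum_comm]
          refine sum_congr rfl fun a _ => ?_
          rw [sum_comm]
          refine sum_congr rfl fun a' _ => ?_
          split_ifs <;> simp [hcod]
      _ ≤ ∑ a ∈ A₀, ∑ a' ∈ A₀, η := by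
          refine sum_le_sum fun a _ => sum_le_sum fun a' _ => ?_
          split_ifs with h1
          · exact h1.le
          · exact hη0.le
      _ = (#A₀ : ℝ) ^ 2 * η := by simp; ring
      _ ≤ n ^ 2 * η := by gcongr
  -- The neighbourhood of a typical `b` is large and contains few pairs of small codegree; averaging
  -- the difference secures both at once.
  obtain ⟨b, -, hb⟩ : ∃ b ∈ B, n ^ 2 / (8 * K ^ 2) ≤ M b ^ 2 - 16 * K * Bd b := by
    refine exists_le_of_sum_le (card_pos.1 (by exact_mod_cast hB ▸ hn)) ?_
    rw [sum_sub_distrib, ← mul_sum, sum_const, nsmul_eq_mul, hB]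
    have h1 : 16 * K * ∑ b ∈ B, Bd b ≤ 16 * K * (n ^ 2 * η) := by gcongr
    have h2 : 16 * K * (n ^ 2 * η) = n ^ 3 / (8 * K ^ 2) := by rw [hη]; field_simp; ring
    have h3 : n ^ 3 / (4 * K ^ 2) = n ^ 3 / (8 * K ^ 2) + n * (n ^ 2 / (8 * K ^ 2)) := by
      field_simp; ring
    linarith
  set f : α → ℝ := fun a => w a b with hf
  set m : ℝ := M b with hm
  have hm0 : 0 ≤ m := sum_nonneg fun a _ => hw0 _ _
  have hBd0 : 0 ≤ Bd b := sum_nonneg fun a _ => sum_nonneg fun a' _ => by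
    split_ifs
    · exact mul_nonneg (hw0 _ _) (hw0 _ _)
    · exact le_rfl
  have hmn : n / (3 * K) ≤ m := by
    refine (pow_le_pow_iff_left₀ (by positivity) hm0 two_ne_zero).1 ?_
    have h1 : (n / (3 * K)) ^ 2 ≤ n ^ 2 / (8 * K ^ 2) := by
      rw [div_pow, mul_pow]; gcongr; norm_num
    have h2 : 0 ≤ 16 * K * Bd b := by positivity
    linarith
  have hmpos : 0 < m := lt_of_lt_of_le (by positivity) hmn
  have hBdm : Bd b ≤ m ^ 2 / (16 * K) := by
    rw [le_div_iff₀ (by positivity)]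
    have : 0 < n ^ 2 / (8 * K ^ 2) := by positivity
    linarith
  set bm : α → ℝ := fun a => ∑ a' ∈ A₀, if cod a a' < η then f a' else 0 with hbm
  have hbm0 : ∀ a, 0 ≤ bm a := fun a => sum_nonneg fun a' _ => by
    split_ifs
    · exact hw0 _ _
    · exact le_rfl
  have hfbm : ∑ a ∈ A₀, f a * bm a = Bd b := by
    rw [hBd]
    refine sum_congr rfl fun a _ => ?_
    rw [hbm, mul_sum]
    refine sum_congr rfl fun a' _ => ?_
    split_ifs <;> simp [hf]
  refine ⟨{a ∈ A₀ | bm a ≤ m / (8 * K)}, (filter_subset _ _).trans hA₀A,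
    {b' ∈ B | m / (4 * K) ≤ ∑ a ∈ A₀, f a * w a b'}, filter_subset _ _, ?_, ?_, ?_⟩
  · have h1 : ∑ a ∈ A₀, f a ≤ ∑ a ∈ A₀, (f a * bm a * (8 * K / m) +
        if bm a ≤ m / (8 * K) then 1 else 0) := by
      refine sum_le_sum fun a _ => ?_
      have hfa : 0 ≤ f a := hw0 _ _
      split_ifs with ha
      · have := hbm0 a
        have : 0 ≤ f a * bm a * (8 * K / m) := by positivity
        linarith [hw1 a b]
      · have : 1 ≤ bm a * (8 * K / m) := by
          rw [not_le] at ha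
          calc (1 : ℝ) = m / (8 * K) * (8 * K / m) := by field_simp
            _ ≤ _ := by gcongr
        nlinarith
    rw [sum_add_distrib, ← sum_mul, hfbm, sum_boole] at h1
    have h2 : Bd b * (8 * K / m) ≤ m ^ 2 / (16 * K) * (8 * K / m) := by gcongr
    have h3 : m ^ 2 / (16 * K) * (8 * K / m) = m / 2 := by field_simp; norm_num
    have h4 : ∑ a ∈ A₀, f a = m := rfl
    have h5 : n / (6 * K) = n / (3 * K) / 2 := by field_simp; norm_num
    linarith
  · have h1 := card_mul_le_mul_card_filter_le B (fun b' => ∑ a ∈ A₀, f a * w a b') (M := m)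
      (c := m / (4 * K)) (by positivity) (fun b' _ => sum_le_sum fun a _ =>
        mul_le_of_le_one_right (hw0 _ _) (hw1 _ _)) ?_
    · rw [hB] at h1
      refine le_of_mul_le_mul_left (le_trans (le_of_eq ?_) h1) hmpos
      field_simp
    · rw [sum_comm, hB]
      calc n * (2 * (m / (4 * K))) = m * (n / (2 * K)) := by field_simp; norm_num
        _ = ∑ a ∈ A₀, f a * (n / (2 * K)) := by rw [← sum_mul]
        _ ≤ ∑ a ∈ A₀, f a * deg a := sum_le_sum fun a ha =>
            mul_le_mul_of_nonneg_left (mem_filter.1 ha).2 (hw0 _ _)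
        _ = _ := by simp only [hdeg, mul_sum]
  · intro a ha b' hb'
    have ha2 := (mem_filter.1 ha).2
    have hb2 := (mem_filter.1 hb').2
    calc n ^ 2 / (3072 * K ^ 5) = η * (n / (3 * K) / (8 * K)) := by rw [hη]; field_simp; norm_num
      _ ≤ η * (m / (8 * K)) := by gcongr
      _ = η * (m / (4 * K) - m / (8 * K)) := by congr 1; field_simp; norm_num
      _ ≤ η * (∑ a' ∈ A₀, f a' * w a' b' - bm a) := by gcongr
      _ = ∑ a' ∈ A₀, η * (f a' * w a' b' - if cod a a' < η then f a' else 0) := by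
          rw [hbm, ← sum_sub_distrib, mul_sum]
      _ ≤ ∑ a' ∈ A₀, cod a a' * w a' b' := by
          -- If `(a, a')` has small codegree, the bracket is `f a' * (w a' b' - 1) ≤ 0`; otherwise
          -- the codegree is at least `η`.
          refine sum_le_sum fun a' _ => ?_
          have h0 := hw0 a' b'
          have hf0 : 0 ≤ f a' := hw0 a' b
          have hf1 : f a' ≤ 1 := hw1 a' b
          split_ifs with hbad
          · have : f a' * w a' b' - f a' ≤ 0 := by nlinarith [hw1 a' b']
            have h1 : η * (f a' * w a' b' - f a') ≤ 0 := by nlinarith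
            exact h1.trans (mul_nonneg (hcod0 _ _) h0)
          · rw [sub_zero]
            rw [not_lt] at hbad
            refine mul_le_mul hbad ?_ (by positivity) (hcod0 _ _)
            exact mul_le_of_le_one_left h0 hf1
      _ ≤ ∑ a' ∈ A, cod a a' * w a' b' :=
          sum_le_sum_of_subset_of_nonneg hA₀A fun a' _ _ => mul_nonneg (hcod0 _ _) (hw0 _ _)
      _ = _ := by simp only [hcod, sum_mul]

open Finset in
/-- Double counting of the pairs in a relation. -/
lemma sum_card_filter_comm {ι κ : Type*} (s : Finset ι) (t : Finset κ) (r : ι → κ → Prop)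
    [∀ i k, Decidable (r i k)] :
    ∑ i ∈ s, #{k ∈ t | r i k} = ∑ k ∈ t, #{i ∈ s | r i k} :=
  sum_card_bipartiteAbove_eq_sum_card_bipartiteBelow r

open Finset in
/-- The additive energy, counted through the popularity of the sums `a + b`. -/
lemma addEnergy_eq_sum_card_filter {G : Type*} [AddCommGroup G] [DecidableEq G]
    (A B : Finset G) :
    addEnergy A B = ∑ p ∈ A ×ˢ B, #{q ∈ A ×ˢ B | q.1 + q.2 = p.1 + p.2} := by
  rw [addEnergy_eq_card_filter, ← card_sigma]
  refine card_nbij' (fun x => ⟨x.1, x.2⟩) (fun x => (x.1, x.2)) ?_ ?_ ?_ ?_ <;>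
    simp +contextual [Set.MapsTo, Set.LeftInvOn]

open Finset in
/-- Sums joined by many weighted paths of length three span few values. -/
lemma sum_paths_le {G : Type*} [AddCommGroup G] [DecidableEq G] (A B A' B' : Finset G) (T : ℕ)
    (h : ∀ a ∈ A', ∀ b ∈ B', T ≤ ∑ a' ∈ A, ∑ b' ∈ B,
      #{q ∈ A ×ˢ B | q.1 + q.2 = a + b'} * #{q ∈ A ×ˢ B | q.1 + q.2 = a' + b'} *
        #{q ∈ A ×ˢ B | q.1 + q.2 = a' + b}) :
    #(A' + B') * T ≤ (#A * #B) ^ 3 := by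
  set P := A ×ˢ B with hP
  have key : ∀ s ∈ A' + B', T ≤
      #{x ∈ P ×ˢ P ×ˢ P | x.1.1 + x.1.2 - (x.2.1.1 + x.2.1.2) + (x.2.2.1 + x.2.2.2) = s} := by
    intro s hs
    obtain ⟨a, ha, b, hb, rfl⟩ := mem_add.1 hs
    refine (h a ha b hb).trans ?_
    rw [← sum_product' (f := fun a' b' => #{q ∈ P | q.1 + q.2 = a + b'} *
      #{q ∈ P | q.1 + q.2 = a' + b'} * #{q ∈ P | q.1 + q.2 = a' + b})]
    simp_rw [mul_assoc, ← card_product]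
    rw [← card_sigma]
    -- With `a` and `b` fixed, the sums `a + b'` and `a' + b` recover the path, so distinct paths
    -- give distinct sextuples.
    refine card_le_card_of_injOn (fun x => x.2) ?_ ?_
    · rintro ⟨⟨a', b'⟩, x⟩ hx
      simp only [coe_sigma, Set.mem_sigma_iff, mem_coe, mem_product, mem_filter] at hx
      simp only [mem_coe, mem_filter, mem_product]
      obtain ⟨_, ⟨h1, e1⟩, ⟨h2, e2⟩, h3, e3⟩ := hx
      refine ⟨⟨h1, h2, h3⟩, ?_⟩
      rw [e1, e2, e3]; abel
    · rintro ⟨⟨a', b'⟩, x⟩ hx ⟨⟨a'', b''⟩, y⟩ hy (rfl : x = y)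
      simp only [coe_sigma, Set.mem_sigma_iff, mem_coe, mem_product, mem_filter] at hx hy
      obtain ⟨_, ⟨h1, e1⟩, ⟨h2, e2⟩, h3, e3⟩ := hx
      obtain ⟨_, ⟨_, e1'⟩, ⟨_, e2'⟩, _, e3'⟩ := hy
      have hb : b' = b'' := add_left_cancel (e1.symm.trans e1')
      have ha : a' = a'' := add_right_cancel (e3.symm.trans e3')
      subst ha hb; rfl
  calc #(A' + B') * T = ∑ s ∈ A' + B', T := by simp
    _ ≤ ∑ s ∈ A' + B', #{x ∈ P ×ˢ P ×ˢ P |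
          x.1.1 + x.1.2 - (x.2.1.1 + x.2.1.2) + (x.2.2.1 + x.2.2.2) = s} := sum_le_sum key
    _ ≤ #(P ×ˢ P ×ˢ P) := by
        rw [sum_card_fiberwise_eq_card_filter]
        exact card_filter_le _ _
    _ = (#A * #B) ^ 3 := by simp only [card_product, hP]; ring

open Finset in
/-- **Balog–Szemerédi–Gowers theorem** for two sets of equal size. -/
theorem balog_szemeredi_gowers {G : Type*} [AddCommGroup G] [DecidableEq G] (A B : Finset G)
    {K : ℝ} (hK : 0 < K) (hA : A.Nonempty) (hAB : #B = #A)
    (h : (#A : ℝ) ^ 3 / K ≤ addEnergy A B) :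
    ∃ A' ⊆ A, ∃ B' ⊆ B, (#A : ℝ) / (6 * K) ≤ #A' ∧ (#A : ℝ) / (6 * K) ≤ #B' ∧
      (#(A' + B') : ℝ) ≤ 3072 * K ^ 5 * #A := by
  set n : ℝ := (#A : ℝ) with hn
  have hn0 : 0 < n := Nat.cast_pos.2 hA.card_pos
  set r : G → ℕ := fun s => #{q ∈ A ×ˢ B | q.1 + q.2 = s} with hr
  have hrn : ∀ s, r s ≤ #A := fun s => by
    refine card_le_card_of_injOn Prod.fst (fun q hq => ?_) ?_
    · exact (mem_product.1 (mem_filter.1 hq).1).1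
    · rintro ⟨a, b⟩ hp ⟨a', b'⟩ hq (rfl : a = a')
      have h1 := (mem_filter.1 hp).2
      have h2 := (mem_filter.1 hq).2
      simp only at h1 h2
      rw [add_left_cancel (h1.trans h2.symm)]
  -- The weight of `(a, b)` is the normalised popularity of `a + b`, so the total weight is the
  -- energy divided by `n`.
  obtain ⟨A', hA', B', hB', hA'n, hB'n, hp⟩ := exists_subsets_many_weighted_paths A B
    (fun a b => (r (a + b) : ℝ) / n) (fun a b => by positivity)
    (fun a b => (div_le_one hn0).2 (Nat.cast_le.2 (hrn _))) hn0 rfl (by rw [hAB]) hK (by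
      have h1 : ∑ a ∈ A, ∑ b ∈ B, (r (a + b) : ℝ) / n = (addEnergy A B : ℝ) / n := by
        rw [addEnergy_eq_sum_card_filter, sum_product]
        push_cast
        simp only [sum_div]
        rfl
      rw [h1, le_div_iff₀ hn0]
      refine le_trans (le_of_eq ?_) h
      ring)
  refine ⟨A', hA', B', hB', hA'n, le_trans ?_ hB'n, ?_⟩
  · gcongr; norm_num
  set t : ℝ := n ^ 5 / (3072 * K ^ 5) with ht
  have h1 := sum_paths_le A B A' B' ⌈t⌉₊ (fun a ha b hb => by
    rw [Nat.ceil_le]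
    have := hp a ha b hb
    have e : ∑ a' ∈ A, ∑ b' ∈ B, (r (a + b') : ℝ) / n * (r (a' + b') / n) * (r (a' + b) / n) =
        (∑ a' ∈ A, ∑ b' ∈ B, (r (a + b') : ℝ) * r (a' + b') * r (a' + b)) / n ^ 3 := by
      simp only [sum_div]
      refine sum_congr rfl fun _ _ => sum_congr rfl fun _ _ => ?_
      field_simp
    rw [e, le_div_iff₀ (by positivity)] at this
    push_cast
    refine le_trans (le_of_eq ?_) this
    rw [ht]; ring)
  rw [hAB] at h1
  have h2 : (#(A' + B') : ℝ) * t ≤ (n * n) ^ 3 := by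
    calc (#(A' + B') : ℝ) * t ≤ #(A' + B') * (⌈t⌉₊ : ℝ) := by gcongr; exact Nat.le_ceil t
      _ ≤ _ := by rw [hn]; exact_mod_cast h1
  rw [ht, mul_div_assoc', div_le_iff₀ (by positivity)] at h2
  refine le_of_mul_le_mul_right (le_trans h2 (le_of_eq ?_)) (by positivity : 0 < n ^ 5)
  ring

/-! ### Cauchy–Schwarz, covering and Ruzsa-type counting. -/

open Finset in
/-- A family of dense subsets has a member meeting many others in a dense set. -/
lemma exists_popular_intersection {ι Ω : Type*} [DecidableEq Ω] (X : Finset ι) (S : ι → Finset Ω)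
    (U : Finset Ω) (hX : X.Nonempty) (hS : ∀ i ∈ X, S i ⊆ U) {δ : ℝ} (hδ : 0 < δ)
    (hU : U.Nonempty) (h : ∀ i ∈ X, δ * #U ≤ #(S i)) :
    ∃ i ∈ X, δ ^ 2 / 2 * #X ≤ (#{j ∈ X | δ ^ 2 / 2 * (#U : ℝ) ≤ #(S j ∩ S i)} : ℝ) := by
  have hU0 : (0 : ℝ) < #U := by exact_mod_cast hU.card_pos
  have hcard : ∀ i ∈ X, ∑ u ∈ U, (if u ∈ S i then (1 : ℝ) else 0) = #(S i) := fun i hi => by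
    rw [sum_boole, filter_mem_eq_inter, inter_eq_right.2 (hS i hi)]
  have h1 : δ * #U * #X ≤ ∑ u ∈ U, (#{i ∈ X | u ∈ S i} : ℝ) := by
    simp_rw [← sum_boole]
    rw [sum_comm, sum_congr rfl hcard]
    calc δ * #U * #X = ∑ i ∈ X, δ * #U := by simp; ring
      _ ≤ _ := sum_le_sum h
  have h2 : ∑ u ∈ U, (#{i ∈ X | u ∈ S i} : ℝ) ^ 2 = ∑ i ∈ X, ∑ j ∈ X, (#(S j ∩ S i) : ℝ) := by
    simp_rw [sq, ← sum_boole, sum_mul_sum]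
    rw [sum_comm]
    refine sum_congr rfl fun i hi => ?_
    rw [sum_comm]
    refine sum_congr rfl fun j hj => ?_
    rw [← inter_eq_right.2 (inter_subset_left.trans (hS j hj) : S j ∩ S i ⊆ U),
      ← filter_mem_eq_inter, ← sum_boole]
    refine sum_congr rfl fun u _ => ?_
    simp only [mem_inter]
    split_ifs <;> simp_all
  have h3 := sq_sum_le_card_mul_sum_sq (s := U) (f := fun u => (#{i ∈ X | u ∈ S i} : ℝ))
  rw [h2] at h3
  have h4 : (δ * #U * #X) ^ 2 ≤ (∑ u ∈ U, (#{i ∈ X | u ∈ S i} : ℝ)) ^ 2 :=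
    pow_le_pow_left₀ (by positivity) h1 2
  obtain ⟨i, hi, h5⟩ : ∃ i ∈ X, δ ^ 2 * #U * #X ≤ ∑ j ∈ X, (#(S j ∩ S i) : ℝ) := by
    refine exists_le_of_sum_le hX ?_
    rw [sum_const, nsmul_eq_mul]
    refine le_of_mul_le_mul_left (le_trans (le_of_eq ?_) (h4.trans h3)) hU0
    ring
  refine ⟨i, hi, ?_⟩
  have h6 := card_mul_le_mul_card_filter_le X (fun j => (#(S j ∩ S i) : ℝ)) (M := #U)
    (c := δ ^ 2 / 2 * #U) (by positivity)
    (fun j hj => by exact_mod_cast card_le_card (inter_subset_left.trans (hS j hj)))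
    (le_trans (le_of_eq (by ring)) h5)
  refine le_of_mul_le_mul_left (le_trans (le_of_eq ?_) h6) hU0
  ring

open Finset in
/-- If the translates of `B` by the values of `f` all lie in a small set `W`, then many pairs of
values of `f` differ by an element of `B - B`. -/
lemma card_sq_mul_card_le_card_mul_collisions {ι G : Type*} [AddCommGroup G] [DecidableEq G]
    (P : Finset ι) (f : ι → G) (B W : Finset G) (h : ∀ i ∈ P, ∀ b ∈ B, f i + b ∈ W) :
    #P ^ 2 * #B ≤ #W * #{p ∈ P ×ˢ P | f p.1 - f p.2 ∈ B - B} := by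
  obtain rfl | hB := B.eq_empty_or_nonempty
  · simp
  have h1 : ∑ w ∈ W, #{i ∈ P | w - f i ∈ B} = #P * #B := by
    rw [sum_card_filter_comm, ← smul_eq_mul, ← sum_const]
    refine sum_congr rfl fun i hi => ?_
    refine card_nbij' (fun w => w - f i) (fun b => f i + b) ?_ ?_ ?_ ?_
    · intro w hw; exact (mem_filter.1 hw).2
    · intro b hb
      simpa using ⟨h i hi b hb, hb⟩
    · intro w _; simp
    · intro b _; simp
  -- A pair lying below a common `w` has its difference in `B - B`, and at most `#B` values of `w`
  -- serve one pair.
  have h2 : ∑ w ∈ W, #{i ∈ P | w - f i ∈ B} ^ 2 ≤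
      #{p ∈ P ×ˢ P | f p.1 - f p.2 ∈ B - B} * #B := by
    calc ∑ w ∈ W, #{i ∈ P | w - f i ∈ B} ^ 2
        = ∑ w ∈ W, #{p ∈ P ×ˢ P | w - f p.1 ∈ B ∧ w - f p.2 ∈ B} := by
          refine sum_congr rfl fun w _ => ?_
          rw [sq, ← card_product, ← filter_product]
      _ = ∑ p ∈ P ×ˢ P, #{w ∈ W | w - f p.1 ∈ B ∧ w - f p.2 ∈ B} := sum_card_filter_comm _ _ _
      _ ≤ ∑ p ∈ P ×ˢ P, if f p.1 - f p.2 ∈ B - B then #B else 0 := by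
          refine sum_le_sum fun p _ => ?_
          split_ifs with hp
          · refine card_le_card_of_injOn (fun w => w - f p.1) ?_ ?_
            · intro w hw; exact (mem_filter.1 hw).2.1
            · intro w _ w' _ e; exact sub_left_injective e
          · rw [Nat.le_zero, card_eq_zero, filter_eq_empty_iff]
            rintro w - ⟨h1, h2⟩
            exact hp (mem_sub.2 ⟨_, h2, _, h1, by abel⟩)
      _ = _ := by rw [← sum_filter, sum_const, smul_eq_mul]
  have h3 := sq_sum_le_card_mul_sum_sq (s := W) (f := fun w => #{i ∈ P | w - f i ∈ B})
  rw [h1] at h3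
  refine Nat.le_of_mul_le_mul_right ?_ hB.card_pos
  calc #P ^ 2 * #B * #B = (#P * #B) ^ 2 := by ring
    _ ≤ #W * (#{p ∈ P ×ˢ P | f p.1 - f p.2 ∈ B - B} * #B) := h3.trans (Nat.mul_le_mul_left _ h2)
    _ = _ := by ring

open Finset in
/-- Some translate of `-T` meets `S` in many points. -/
lemma exists_card_mul_card_le_card_add_mul {G : Type*} [AddCommGroup G] [DecidableEq G]
    (S T : Finset G) : ∃ s, #S * #T ≤ #(S + T) * #{a ∈ S | s - a ∈ T} := by
  have h1 : ∑ s ∈ S + T, #{a ∈ S | s - a ∈ T} = #S * #T := by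
    rw [sum_card_filter_comm, ← smul_eq_mul, ← sum_const]
    refine sum_congr rfl fun a ha => ?_
    refine card_nbij' (fun s => s - a) (fun t => a + t) ?_ ?_ ?_ ?_
    · intro w hw; exact (mem_filter.1 hw).2
    · intro b hb
      simpa using ⟨add_mem_add ha hb, hb⟩
    · intro w _; simp
    · intro b _; simp
  obtain hST | hST := (S + T).eq_empty_or_nonempty
  · refine ⟨0, ?_⟩
    rw [← h1, hST]; simp
  · obtain ⟨s, -, hs⟩ := exists_max_image (S + T) (fun s => #{a ∈ S | s - a ∈ T}) hST
    refine ⟨s, ?_⟩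
    rw [← h1, ← smul_eq_mul]
    exact sum_le_card_nsmul _ _ _ hs

open Finset in
/-- If every element of `N` is carried into `V` by many translations from `B`, then `A + N` is
small. -/
lemma card_add_mul_le_of_translates {G : Type*} [AddCommGroup G] [DecidableEq G]
    (A N V B : Finset G) (ρ : ℝ) (h : ∀ u ∈ N, ρ ≤ #{a ∈ B | u + a ∈ V}) :
    (#(A + N) : ℝ) * ρ ≤ #V * #(A - B) := by
  have key : ∀ w ∈ A + N, ρ ≤ (#{x ∈ V ×ˢ (A - B) | x.1 + x.2 = w} : ℝ) := by
    intro w hw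
    obtain ⟨a₀, ha₀, u, hu, rfl⟩ := mem_add.1 hw
    refine (h u hu).trans ?_
    norm_cast
    refine card_le_card_of_injOn (fun a => (u + a, a₀ - a)) ?_ ?_
    · intro a ha
      have ha := mem_filter.1 ha
      simp only [mem_coe, mem_filter, mem_product]
      exact ⟨⟨ha.2, sub_mem_sub ha₀ ha.1⟩, by abel⟩
    · intro a _ a' _ e
      exact add_left_cancel (Prod.ext_iff.1 e).1
  calc (#(A + N) : ℝ) * ρ = ∑ w ∈ A + N, ρ := by simp
    _ ≤ ∑ w ∈ A + N, (#{x ∈ V ×ˢ (A - B) | x.1 + x.2 = w} : ℝ) := sum_le_sum key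
    _ ≤ (#(V ×ˢ (A - B)) : ℝ) := by
        norm_cast
        rw [sum_card_fiberwise_eq_card_filter]
        exact card_filter_le _ _
    _ = _ := by simp

open Finset in
/-- A chain of three Ruzsa triangle inequalities. -/
lemma card_add_sub_mul_le_chain {G : Type*} [AddCommGroup G] [DecidableEq G]
    (U U' C V : Finset G) :
    #(U + V) * (#C * #U') ≤ #(U + U') * #(U' + C) * #(C + V) ∧
      #(U - V) * (#C * #U') ≤ #(U + U') * #(U' + C) * #(C + V) := by
  have h1 := ruzsa_triangle_inequality_add_add_add U U' C
  have h2 := ruzsa_triangle_inequality_add_add_add U C V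
  have h3 := ruzsa_triangle_inequality_sub_add_add U C V
  rw [add_comm V C] at h3
  constructor
  · calc #(U + V) * (#C * #U') = #(U + V) * #C * #U' := by ring
      _ ≤ #(U + C) * #(C + V) * #U' := by gcongr
      _ = #(U + C) * #U' * #(C + V) := by ring
      _ ≤ _ := by gcongr
  · calc #(U - V) * (#C * #U') = #(U - V) * #C * #U' := by ring
      _ ≤ #(U + C) * #(C + V) * #U' := by gcongr
      _ = #(U + C) * #U' * #(C + V) := by ring
      _ ≤ _ := by gcongr

open Finset in
/-- If `ξ • B'` and `η • B` both have small sumset with a common set, then some translate of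
`(η⁻¹ * ξ) • B` meets `B` in many points. -/
lemma exists_translate_dilate_inter {F : Type*} [Field F] [DecidableEq F] (A A' B B' : Finset F)
    {ξ η : F} (hξ : ξ ≠ 0) (hη : η ≠ 0) (hA : A' ⊆ A) (hB : B' ⊆ B) :
    ∃ t, #A' * #B' * #B ≤ #(A' + ξ • B') * #(A + η • B) *
      #{b ∈ B | η⁻¹ * ξ * b - t ∈ B} := by
  obtain ⟨s, hs⟩ := exists_card_mul_card_le_card_add_mul A' (ξ • B')
  set A'' := {a ∈ A' | s - a ∈ ξ • B'} with hA''
  obtain ⟨s', hs'⟩ := exists_card_mul_card_le_card_add_mul (η • B) A''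
  have hcard : ∀ (x : F), x ≠ 0 → ∀ S : Finset F, #(x • S) = #S := fun x hx S => by
    rw [← Units.val_mk0 hx]; exact card_smul_finset (Units.mk0 x hx) S
  rw [hcard ξ hξ] at hs
  rw [hcard η hη] at hs'
  -- For `u ∈ η • B` with `s' - u ∈ A''`, also `s - s' + u ∈ ξ • B'`. Thus `ξ * b = s - s' + u` for
  -- some `b ∈ B'`, and dividing by `η` gives the shift.
  refine ⟨η⁻¹ * (s - s'), ?_⟩
  have h1 : #(η • B + A'') ≤ #(A + η • B) := by
    rw [add_comm A]
    exact card_le_card (add_subset_add_left ((filter_subset _ _).trans hA))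
  have h2 : #{a ∈ η • B | s' - a ∈ A''} ≤ #{b ∈ B | η⁻¹ * ξ * b - η⁻¹ * (s - s') ∈ B} := by
    refine card_le_card_of_injOn (fun u => ξ⁻¹ * (s - s' + u)) ?_ ?_
    · intro u hu
      obtain ⟨hu, hu'⟩ := mem_filter.1 hu
      obtain ⟨b', hb', rfl⟩ := mem_smul_finset.1 hu
      obtain ⟨b, hb, e⟩ := mem_smul_finset.1 (mem_filter.1 hu').2
      simp only [smul_eq_mul] at e ⊢
      have e2 : ξ⁻¹ * (s - s' + η * b') = b := by
        rw [show s - s' + η * b' = ξ * b by rw [e]; ring, inv_mul_cancel_left₀ hξ]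
      simp only [mem_coe, mem_filter]
      rw [e2]
      refine ⟨hB hb, ?_⟩
      have : η⁻¹ * ξ * b - η⁻¹ * (s - s') = b' := by
        rw [mul_assoc, e, ← mul_sub, show s - (s' - η * b') - (s - s') = η * b' by ring,
          inv_mul_cancel_left₀ hη]
      rwa [this]
    · intro u _ u' _ e
      have := mul_left_cancel₀ (inv_ne_zero hξ) e
      exact add_left_cancel this
  calc #A' * #B' * #B ≤ #(A' + ξ • B') * #A'' * #B := by gcongr
    _ = #(A' + ξ • B') * (#B * #A'') := by ring
    _ ≤ #(A' + ξ • B') * (#(η • B + A'') * #{a ∈ η • B | s' - a ∈ A''}) := by gcongr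
    _ ≤ #(A' + ξ • B') * (#(A + η • B) * #{b ∈ B | η⁻¹ * ξ * b - η⁻¹ * (s - s') ∈ B}) := by
        gcongr
    _ = _ := by ring

/-! ### Bourgain's lemma. -/

open Finset in
lemma card_dilate {F : Type*} [Field F] [DecidableEq F] {x : F} (hx : x ≠ 0) (S : Finset F) :
    #(x • S) = #S := by
  rw [← Units.val_mk0 hx]; exact card_smul_finset (Units.mk0 x hx) S

open Finset in
/-- Additive energy of `B` with a dilate, counted through dilated differences. -/
lemma addEnergy_dilate_le {F : Type*} [Field F] [DecidableEq F] (B : Finset F) {y : F}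
    (hy : y ≠ 0) :
    addEnergy B (y • B) ≤ ∑ c ∈ B, ∑ b ∈ B, #{a ∈ B | y * (b - c) + a ∈ B} := by
  rw [← sum_product' (f := fun c b => #{a ∈ B | y * (b - c) + a ∈ B}), ← card_sigma]
  refine card_le_card_of_injOn (fun x => ⟨(y⁻¹ * x.2.2, y⁻¹ * x.2.1), x.1.1⟩) ?_ ?_
  · rintro ⟨⟨a₁, a₂⟩, t₁, t₂⟩ hx
    simp only [mem_coe, mem_filter, mem_product] at hx
    obtain ⟨⟨⟨h1, h2⟩, h3, h4⟩, e⟩ := hx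
    obtain ⟨b₁, hb₁, rfl⟩ := mem_smul_finset.1 h3
    obtain ⟨b₂, hb₂, rfl⟩ := mem_smul_finset.1 h4
    simp only [smul_eq_mul, inv_mul_cancel_left₀ hy, coe_sigma, Set.mem_sigma_iff, mem_coe,
      mem_product, mem_filter] at e ⊢
    refine ⟨⟨hb₂, hb₁⟩, h1, ?_⟩
    rwa [show y * (b₁ - b₂) + a₁ = a₂ by linear_combination e]
  · rintro ⟨⟨a₁, a₂⟩, t₁, t₂⟩ hx ⟨⟨a₁', a₂'⟩, t₁', t₂'⟩ hx' e
    have e1 := (mem_filter.1 hx).2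
    have e2 := (mem_filter.1 hx').2
    simp only [Sigma.mk.injEq, Prod.mk.injEq, mul_eq_mul_left_iff, inv_eq_zero, hy, or_false,
      heq_eq_eq] at e e1 e2
    obtain ⟨⟨rfl, rfl⟩, rfl⟩ := e
    have : a₂ = a₂' := add_right_cancel (e1.symm.trans e2)
    rw [this]

open Finset in
/-- The elements `u` that many pairs of distinct elements of `X` send, up to a shift depending on
the pair only, into a given set, are few. -/
lemma card_filter_many_pairs_mul_le {F : Type*} [Field F] [Fintype F] [DecidableEq F]
    (X D : Finset F) (t : F → F) (τ : ℝ) :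
    (#{u : F | τ ≤ (#{p ∈ X ×ˢ X | p.1 ≠ p.2 ∧
      (p.1 - p.2) * u - (t p.1 - t p.2) ∈ D} : ℝ)} : ℝ) * τ ≤ (#X : ℝ) ^ 2 * #D := by
  set N : F → ℕ := fun u => #{p ∈ X ×ˢ X | p.1 ≠ p.2 ∧ (p.1 - p.2) * u - (t p.1 - t p.2) ∈ D}
  calc (#{u : F | τ ≤ (N u : ℝ)} : ℝ) * τ = ∑ u : F with τ ≤ (N u : ℝ), τ := by simp
    _ ≤ ∑ u : F with τ ≤ (N u : ℝ), (N u : ℝ) := sum_le_sum fun u hu => (mem_filter.1 hu).2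
    _ ≤ ∑ u : F, (N u : ℝ) :=
        sum_le_sum_of_subset_of_nonneg (filter_subset _ _) fun _ _ _ => by positivity
    _ ≤ (#X : ℝ) ^ 2 * #D := by
        norm_cast
        simp only [N]
        rw [sum_card_filter_comm, sq, ← card_product, ← smul_eq_mul]
        refine sum_le_card_nsmul _ _ _ fun p _ => ?_
        refine card_le_card_of_injOn (fun u => (p.1 - p.2) * u - (t p.1 - t p.2)) ?_ ?_
        · intro u hu; exact (mem_filter.1 hu).2.2
        · intro u hu u' _ e
          exact mul_left_cancel₀ (sub_ne_zero.2 (mem_filter.1 hu).2.1) (sub_left_injective e)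

open Finset in
/-- For a fixed `v` that many `y ∈ P` send into a translate of `B`, most translates of `z * v` by
elements of `B` are sent, up to shifts, into `2B - 2B` by many differences of elements of `P`. -/
lemma many_translates_of_dilates {F : Type*} [Field F] [DecidableEq F] (B P : Finset F)
    (t : F → F) {z v c : F} (hv : ∀ y ∈ P, y * v + c ∈ B) {σ M : ℝ} (hσ : 0 < σ)
    (hcell : ∀ y ∈ P, 2 * σ * #B ≤ (#{b ∈ B | y * b - t y ∈ B} : ℝ))
    (hP : P.Nonempty) (hM : (#(B + z • B) : ℝ) ≤ M * #B) :
    σ * #B ≤ (#{a ∈ B | (σ * #P) ^ 2 ≤ M * (#{p ∈ P ×ˢ P |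
      (p.1 - p.2) * (z * v + a) - (t p.1 - t p.2) ∈ B - B + (B - B)} : ℝ)} : ℝ) := by
  obtain rfl | hB := B.eq_empty_or_nonempty
  · simp
  have hP0 : (0 : ℝ) < #P := by exact_mod_cast hP.card_pos
  have hB0 : (0 : ℝ) < #B := by exact_mod_cast hB.card_pos
  have hM0 : 0 ≤ M := by
    by_contra! h
    have : (0 : ℝ) ≤ M * #B := le_trans (by positivity) hM
    nlinarith
  have h1 : (#B : ℝ) * (2 * (σ * #P)) ≤ ∑ a ∈ B, (#{y ∈ P | y * a - t y ∈ B} : ℝ) := by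
    have e := sum_card_filter_comm B P (fun a y => y * a - t y ∈ B)
    have e' : ∑ a ∈ B, (#{y ∈ P | y * a - t y ∈ B} : ℝ) =
        ∑ y ∈ P, (#{a ∈ B | y * a - t y ∈ B} : ℝ) := by exact_mod_cast e
    rw [e']
    calc (#B : ℝ) * (2 * (σ * #P)) = ∑ y ∈ P, 2 * σ * #B := by simp; ring
      _ ≤ _ := sum_le_sum hcell
  have h2 := card_mul_le_mul_card_filter_le B (fun a => (#{y ∈ P | y * a - t y ∈ B} : ℝ))
    (M := #P) (c := σ * #P) (by positivity)
    (fun a _ => by exact_mod_cast card_filter_le _ _) h1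
  have h3 : σ * #B ≤ (#{a ∈ B | σ * #P ≤ (#{y ∈ P | y * a - t y ∈ B} : ℝ)} : ℝ) := by
    refine le_of_mul_le_mul_left (le_trans (le_of_eq ?_) h2) hP0
    ring
  refine h3.trans ?_
  norm_cast
  refine card_le_card fun a ha => ?_
  obtain ⟨ha, ha'⟩ := mem_filter.1 ha
  refine mem_filter.2 ⟨ha, ?_⟩
  set Q := {y ∈ P | y * a - t y ∈ B} with hQ
  -- The points `z * (y * v + c)` lie in `z • B`, whose sum with `B` is small, so many pairs have
  -- `(y - y') * z * v ∈ B - B`. Adding `(y - y') * a - (t y - t y') ∈ B - B`, valid on `Q`, gives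
  -- the claim.
  have h4 := card_sq_mul_card_le_card_mul_collisions Q (fun y => z * (y * v + c)) B (z • B + B)
    (fun y hy b hb => add_mem_add (smul_mem_smul_finset (hv y (mem_filter.1 hy).1)) hb)
  have h5 : #{p ∈ Q ×ˢ Q | z * (p.1 * v + c) - z * (p.2 * v + c) ∈ B - B} ≤
      #{p ∈ P ×ˢ P | (p.1 - p.2) * (z * v + a) - (t p.1 - t p.2) ∈ B - B + (B - B)} := by
    refine card_le_card fun p hp => ?_
    obtain ⟨hp, hp'⟩ := mem_filter.1 hp
    obtain ⟨hp1, hp2⟩ := mem_product.1 hp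
    obtain ⟨hp1, hp1'⟩ := mem_filter.1 hp1
    obtain ⟨hp2, hp2'⟩ := mem_filter.1 hp2
    refine mem_filter.2 ⟨mem_product.2 ⟨hp1, hp2⟩, ?_⟩
    have := add_mem_add hp' (sub_mem_sub hp1' hp2')
    convert this using 1
    ring
  rw [add_comm (z • B)] at h4
  have h6 : (#Q : ℝ) ^ 2 * #B ≤ #(B + z • B) *
      (#{p ∈ P ×ˢ P | (p.1 - p.2) * (z * v + a) - (t p.1 - t p.2) ∈ B - B + (B - B)} : ℝ) := by
    exact_mod_cast h4.trans (Nat.mul_le_mul_left _ h5)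
  refine le_of_mul_le_mul_right ?_ hB0
  calc (σ * #P) ^ 2 * (#B : ℝ) ≤ (#Q : ℝ) ^ 2 * #B := by gcongr
    _ ≤ _ := h6
    _ ≤ M * #B *
      (#{p ∈ P ×ˢ P | (p.1 - p.2) * (z * v + a) - (t p.1 - t p.2) ∈ B - B + (B - B)} : ℝ) := by
        gcongr
    _ = _ := by ring

lemma card_sub_singleton {G : Type*} [AddGroup G] [DecidableEq G] (S : Finset G) (c : G) :
    (S - {c}).card = S.card := by
  rw [Finset.sub_singleton]
  exact Finset.card_image_of_injective _ sub_left_injective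

-- Translating `B` by `-c` moves the whole sumset by `-(c + y * c)`. Bounds for `B` thus pass to
-- `A₁`; `y = 1` covers doubling.
open Finset in
lemma card_add_dilate_le_of_subset {F : Type*} [Field F] [DecidableEq F] {A B : Finset F} {c : F}
    (h : A ⊆ B - {c}) (y : F) : #(A + y • A) ≤ #(B + y • B) := by
  rw [← card_sub_singleton (B + y • B) (c + y * c)]
  refine card_le_card fun w hw => ?_
  obtain ⟨a, ha, u, hu, rfl⟩ := mem_add.1 hw
  obtain ⟨a', ha', rfl⟩ := mem_smul_finset.1 hu
  obtain ⟨b, hb, d, hd, rfl⟩ := mem_sub.1 (h ha)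
  obtain ⟨b', hb', d', hd', rfl⟩ := mem_sub.1 (h ha')
  rw [mem_singleton.1 hd, mem_singleton.1 hd', smul_eq_mul,
    show b - c + y * (b' - c) = b + y * b' - (c + y * c) by ring]
  exact sub_mem_sub (add_mem_add hb (smul_mem_smul_finset hb')) (mem_singleton_self _)

open Finset in
lemma card_sub_dilate_le_of_subset {F : Type*} [Field F] [DecidableEq F] {A B : Finset F} {c : F}
    (h : A ⊆ B - {c}) (y : F) : #(A - y • A) ≤ #(B - y • B) := by
  have e : ∀ S : Finset F, S - y • S = S + (-y) • S := fun S => by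
    rw [sub_eq_add_neg, ← neg_smul_finset]
  rw [e, e]
  exact card_add_dilate_le_of_subset h (-y)

open Finset in
/-- **Bourgain's lemma**: if `B` has small doubling and `B + y • B` is small for every `y ∈ X`,
then a large piece `A₁` of a translate of `B` has `A₁ + X * A₁` small. -/
theorem exists_subset_card_add_mul_le {F : Type*} [Field F] [Fintype F] [DecidableEq F]
    (B X : Finset F) {κ n : ℝ} (hκ : 4 ≤ κ) (hn : 0 < n) (hBn : (#B : ℝ) ≤ n)
    (hnB : n ≤ κ * #B) (hX : X.Nonempty) (hX0 : ∀ y ∈ X, y ≠ 0)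
    (hD : (#(B - B) : ℝ) ≤ κ ^ 12 * n) (hDD : (#(B - B + (B - B)) : ℝ) ≤ κ ^ 24 * n)
    (hadd : ∀ y ∈ X, (#(B + y • B) : ℝ) ≤ κ ^ 27 * n)
    (hcell : ∀ y ∈ X, ∃ t, n ≤ κ ^ 16 * (#{b ∈ B | y * b - t ∈ B} : ℝ)) :
    ∃ c ∈ B, ∃ A₁ ⊆ B - {c}, n ≤ κ ^ 30 * (#A₁ : ℝ) ∧
      (#(A₁ + X * A₁) : ℝ) ≤ κ ^ 173 * n := by
  have hκ0 : 0 < κ := by linarith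
  have hκ1 : 1 ≤ κ := by linarith
  set m : ℝ := (#B : ℝ) with hm
  have hm0 : 0 < m := by
    by_contra! h
    nlinarith
  have hx0 : (0 : ℝ) < #X := by exact_mod_cast hX.card_pos
  have hadd' : ∀ y ∈ X, (#(B + y • B) : ℝ) ≤ κ ^ 28 * m := fun y hy => by
    calc _ ≤ κ ^ 27 * n := hadd y hy
      _ ≤ κ ^ 27 * (κ * m) := by gcongr
      _ = _ := by ring
  have henergy : ∀ y ∈ X, m ^ 3 / κ ^ 28 ≤
      ∑ c ∈ B, ∑ b ∈ B, (#{a ∈ B | y * (b - c) + a ∈ B} : ℝ) := fun y hy => by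
    have h1 : (m ^ 2 * m ^ 2 : ℝ) ≤ #(B + y • B) * (addEnergy B (y • B) : ℝ) := by
      have := le_card_add_mul_addEnergy B (y • B)
      rw [card_dilate (hX0 y hy)] at this
      rw [hm]; exact_mod_cast this
    have h2 : (addEnergy B (y • B) : ℝ) ≤
        ∑ c ∈ B, ∑ b ∈ B, (#{a ∈ B | y * (b - c) + a ∈ B} : ℝ) := by
      exact_mod_cast addEnergy_dilate_le B (hX0 y hy)
    refine le_trans ?_ h2
    rw [div_le_iff₀ (by positivity)]
    refine le_of_mul_le_mul_left ?_ hm0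
    calc m * m ^ 3 = m ^ 2 * m ^ 2 := by ring
      _ ≤ _ := h1
      _ ≤ κ ^ 28 * m * (addEnergy B (y • B) : ℝ) := by gcongr; exact hadd' y hy
      _ = _ := by ring
  set g : F → F → ℝ := fun y v => (#{a ∈ B | y * v + a ∈ B} : ℝ) with hg
  have hgm : ∀ y v, g y v ≤ m := fun y v => Nat.cast_le.2 (card_filter_le _ _)
  -- One base point `c` serves all `y ∈ X` on average; the popular `b` then form `B'`, and `A₁` is
  -- `B' - {c}`.
  obtain ⟨c, hc, hcsum⟩ : ∃ c ∈ B, #X * m ^ 2 / κ ^ 28 ≤ ∑ b ∈ B, ∑ y ∈ X, g y (b - c) := by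
    refine exists_le_of_sum_le (card_pos.1 (Nat.cast_pos.1 hm0)) ?_
    calc ∑ c ∈ B, #X * m ^ 2 / κ ^ 28 = ∑ y ∈ X, m ^ 3 / κ ^ 28 := by
          simp only [sum_const, nsmul_eq_mul, ← hm]; ring
      _ ≤ ∑ y ∈ X, ∑ c ∈ B, ∑ b ∈ B, g y (b - c) := sum_le_sum henergy
      _ = ∑ c ∈ B, ∑ b ∈ B, ∑ y ∈ X, g y (b - c) := by
          rw [sum_comm]
          exact sum_congr rfl fun _ _ => sum_comm
  set s : ℝ := #X * m / (2 * κ ^ 28) with hs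
  set B' := {b ∈ B | s ≤ ∑ y ∈ X, g y (b - c)} with hB'
  have hB'm : m ≤ 2 * κ ^ 28 * #B' := by
    have h1 := card_mul_le_mul_card_filter_le B (fun b => ∑ y ∈ X, g y (b - c)) (M := #X * m)
      (c := s) (by positivity)
      (fun b _ => by
        calc ∑ y ∈ X, g y (b - c) ≤ ∑ y ∈ X, m := sum_le_sum fun y _ => hgm _ _
          _ = _ := by simp)
      (le_trans (le_of_eq (by rw [← hm, hs]; field_simp)) hcsum)
    rw [← hm, ← hB', hs, mul_div_assoc', div_le_iff₀ (by positivity)] at h1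
    refine le_of_mul_le_mul_left (le_trans (le_of_eq ?_) (h1.trans (le_of_eq ?_)))
      (by positivity : 0 < #X * m)
    · ring
    · ring
  set A₁ := B' - {c} with hA₁
  have hA₁card : #A₁ = #B' := by
    rw [hA₁, card_sub_singleton]
  have hA₁B : A₁ ⊆ B - {c} := sub_subset_sub_right (filter_subset _ _)
  have hA₁n : n ≤ κ ^ 30 * (#A₁ : ℝ) := by
    rw [hA₁card]
    calc n ≤ κ * m := hnB
      _ ≤ κ * (2 * κ ^ 28 * #B') := by gcongr
      _ ≤ κ * (κ * κ ^ 28 * #B') := by gcongr; linarith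
      _ = _ := by ring
  refine ⟨c, hc, A₁, hA₁B, hA₁n, ?_⟩
  -- For small `X` a union bound over `y` suffices. For large `X` the diagonal pairs, `#X` in
  -- number, are at most half of the `#X ^ 2 / κ ^ 118` collisions found below and can be dropped.
  obtain hsmall | hlarge := lt_or_ge (#X : ℝ) (2 * κ ^ 118)
  · have h1 : A₁ + X * A₁ ⊆ X.biUnion fun y => A₁ + y • A₁ := by
      intro w hw
      obtain ⟨a, ha, u, hu, rfl⟩ := mem_add.1 hw
      obtain ⟨y, hy, v, hv, rfl⟩ := mem_mul.1 hu
      exact mem_biUnion.2 ⟨y, hy, add_mem_add ha (smul_mem_smul_finset hv)⟩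
    calc (#(A₁ + X * A₁) : ℝ) ≤ ∑ y ∈ X, (#(A₁ + y • A₁) : ℝ) := by
          exact_mod_cast (card_le_card h1).trans card_biUnion_le
      _ ≤ ∑ y ∈ X, κ ^ 27 * n := sum_le_sum fun y hy =>
          (Nat.cast_le.2 (card_add_dilate_le_of_subset hA₁B y)).trans (hadd y hy)
      _ = #X * (κ ^ 27 * n) := by simp
      _ ≤ 2 * κ ^ 118 * (κ ^ 27 * n) := by gcongr
      _ ≤ κ * κ ^ 118 * (κ ^ 27 * n) := by gcongr; linarith
      _ = κ ^ 146 * n := by ring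
      _ ≤ κ ^ 173 * n := by gcongr; norm_num
  choose! t ht using hcell
  set D := B - B + (B - B) with hDdef
  set τ : ℝ := (#X : ℝ) ^ 2 / κ ^ 119 with hτ
  have hτ0 : 0 < τ := by positivity
  set V : Finset F := {u : F | τ ≤ (#{p ∈ X ×ˢ X | p.1 ≠ p.2 ∧
      (p.1 - p.2) * u - (t p.1 - t p.2) ∈ D} : ℝ)} with hV
  have hVcard : (#V : ℝ) ≤ κ ^ 143 * n := by
    refine le_of_mul_le_mul_right ?_ hτ0
    calc (#V : ℝ) * τ ≤ (#X : ℝ) ^ 2 * #D := card_filter_many_pairs_mul_le X D t τ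
      _ ≤ (#X : ℝ) ^ 2 * (κ ^ 24 * n) := by gcongr
      _ = κ ^ 143 * n * τ := by rw [hτ]; field_simp
  have hN : ∀ u ∈ X * A₁, m / κ ^ 17 ≤ (#{a ∈ B | u + a ∈ V} : ℝ) := by
    intro u hu
    obtain ⟨z, hz, v, hv, rfl⟩ := mem_mul.1 hu
    have hvs : s ≤ ∑ a ∈ B, (#{y ∈ X | y * v + a ∈ B} : ℝ) := by
      have e : ∑ a ∈ B, (#{y ∈ X | y * v + a ∈ B} : ℝ) = ∑ y ∈ X, g y v := by
        simp only [hg]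
        exact_mod_cast sum_card_filter_comm B X (fun a y => y * v + a ∈ B)
      rw [e]
      obtain ⟨b, hb, c', hc', rfl⟩ := mem_sub.1 hv
      rw [mem_singleton.1 hc']
      exact (mem_filter.1 hb).2
    obtain ⟨a', -, ha'⟩ : ∃ a ∈ B, (#X : ℝ) / (2 * κ ^ 28) ≤ (#{y ∈ X | y * v + a ∈ B} : ℝ) := by
      refine exists_le_of_sum_le (card_pos.1 (Nat.cast_pos.1 hm0)) (le_trans (le_of_eq ?_) hvs)
      rw [sum_const, nsmul_eq_mul, ← hm, hs]; ring
    set P := {y ∈ X | y * v + a' ∈ B} with hP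
    have hP0 : (0 : ℝ) < #P := lt_of_lt_of_le (by positivity) ha'
    have h1 := many_translates_of_dilates B P t (z := z) (v := v) (c := a')
      (fun y hy => (mem_filter.1 hy).2) (σ := 1 / (2 * κ ^ 16)) (M := κ ^ 28) (by positivity)
      (fun y hy => by
        have := ht y (mem_filter.1 hy).1
        have e : 2 * (1 / (2 * κ ^ 16)) * (#B : ℝ) = m / κ ^ 16 := by rw [← hm]; field_simp
        rw [e, div_le_iff₀ (by positivity), mul_comm]
        exact hBn.trans this)
      (card_pos.1 (Nat.cast_pos.1 hP0)) (hadd' z hz)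
    calc m / κ ^ 17 ≤ 1 / (2 * κ ^ 16) * m := by
          rw [one_div_mul_eq_div]
          gcongr
          calc 2 * κ ^ 16 ≤ κ * κ ^ 16 := by gcongr; linarith
            _ = κ ^ 17 := by ring
      _ ≤ _ := h1
      _ ≤ _ := by
          refine Nat.cast_le.2 (card_le_card fun a ha => ?_)
          obtain ⟨ha, ha'⟩ := mem_filter.1 ha
          refine mem_filter.2 ⟨ha, mem_filter.2 ⟨mem_univ _, ?_⟩⟩
          set S := {p ∈ P ×ˢ P | (p.1 - p.2) * (z * v + a) - (t p.1 - t p.2) ∈ D} with hS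
          -- The exponent is `28 + 2 * 45`: 28 from the doubling factor `M`, and 45 from `σ * #P ≥
          -- #X / κ ^ 45`, where `4 ≤ κ` absorbs the two factors 2.
          have h2 : (#X : ℝ) ^ 2 / κ ^ 118 ≤ #S := by
            refine le_of_mul_le_mul_left (le_trans ?_ ha') (by positivity : 0 < κ ^ 28)
            calc κ ^ 28 * ((#X : ℝ) ^ 2 / κ ^ 118) = (#X / κ ^ 45) ^ 2 := by field_simp
              _ ≤ (1 / (2 * κ ^ 16) * (#X / (2 * κ ^ 28))) ^ 2 := by
                  gcongr
                  rw [one_div_mul_eq_div, div_div]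
                  gcongr
                  calc 2 * κ ^ 28 * (2 * κ ^ 16) = 4 * κ ^ 44 := by ring
                    _ ≤ κ * κ ^ 44 := by gcongr
                    _ = _ := by ring
              _ ≤ _ := by gcongr
          have h3 : #S ≤ #{p ∈ X ×ˢ X | p.1 ≠ p.2 ∧
              (p.1 - p.2) * (z * v + a) - (t p.1 - t p.2) ∈ D} + #X := by
            have h4 : S ⊆ {p ∈ X ×ˢ X | p.1 ≠ p.2 ∧
                (p.1 - p.2) * (z * v + a) - (t p.1 - t p.2) ∈ D} ∪ X.diag := by
              intro p hp
              obtain ⟨hp, hp'⟩ := mem_filter.1 hp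
              obtain ⟨hp1, hp2⟩ := mem_product.1 hp
              have hp1 := (mem_filter.1 hp1).1
              have hp2 := (mem_filter.1 hp2).1
              by_cases e : p.1 = p.2
              · exact mem_union_right _ (mem_diag.2 ⟨hp1, e⟩)
              · exact mem_union_left _ (mem_filter.2 ⟨mem_product.2 ⟨hp1, hp2⟩, e, hp'⟩)
            refine (card_le_card h4).trans ((card_union_le _ _).trans ?_)
            rw [diag_card]
          have h3' : (#S : ℝ) ≤ (#{p ∈ X ×ˢ X | p.1 ≠ p.2 ∧
              (p.1 - p.2) * (z * v + a) - (t p.1 - t p.2) ∈ D} : ℝ) + #X := by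
            exact_mod_cast h3
          have h5 : τ + #X ≤ (#X : ℝ) ^ 2 / κ ^ 118 := by
            have h6 : τ ≤ (#X : ℝ) ^ 2 / κ ^ 118 / 2 := by
              rw [hτ, div_div]
              gcongr
              calc κ ^ 118 * 2 ≤ κ ^ 118 * κ := by gcongr; linarith
                _ = _ := by ring
            have h7 : (#X : ℝ) ≤ (#X : ℝ) ^ 2 / κ ^ 118 / 2 := by
              rw [div_div, le_div_iff₀ (by positivity), sq]
              gcongr
              linarith
            linarith
          linarith
  have h1 := card_add_mul_le_of_translates A₁ (X * A₁) V B _ hN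
  have h2 : (#(A₁ - B) : ℝ) ≤ κ ^ 12 * n := by
    refine le_trans ?_ hD
    have : #(A₁ - B) ≤ #(B - B - {c}) := by
      refine card_le_card ?_
      rw [sub_right_comm B B]
      exact sub_subset_sub_right hA₁B
    rw [card_sub_singleton] at this
    exact_mod_cast this
  have h3 : (#(A₁ + X * A₁) : ℝ) * (m / κ ^ 17) ≤ κ ^ 143 * n * (κ ^ 12 * n) :=
    h1.trans (by gcongr)
  refine le_of_mul_le_mul_right (h3.trans ?_) (by positivity : 0 < m / κ ^ 17)
  calc κ ^ 143 * n * (κ ^ 12 * n) ≤ κ ^ 143 * n * (κ ^ 12 * (κ * m)) := by gcongr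
    _ = κ ^ 173 * n * (m / κ ^ 17) := by field_simp

/-! ### A large subset nearly preserved by many dilates. -/

open Finset in
/-- The sum and difference sets of `B`, bounded through the sumset of `B` with some `A`. -/
lemma card_add_self_le_of_card_add_le {G : Type*} [AddCommGroup G] [DecidableEq G] {A B : Finset G}
    (hA : A.Nonempty) {ρ : ℝ} (h : (#(A + B) : ℝ) ≤ ρ * #A) :
    (#(B + B) : ℝ) ≤ ρ ^ 2 * #A ∧ (#(B - B) : ℝ) ≤ ρ ^ 2 * #A ∧
      (#(B - B + (B - B)) : ℝ) ≤ ρ ^ 4 * #A := by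
  have hA0 : (0 : ℝ) < #A := by exact_mod_cast hA.card_pos
  have hρ : (#(A + B) : ℝ) / #A ≤ ρ := (div_le_iff₀ hA0).2 h
  refine ⟨?_, ?_, ?_⟩
  · have h1 := pluennecke_ruzsa_inequality_nsmul_sub_nsmul_add hA B 2 0
    rw [two_nsmul, zero_nsmul, sub_zero] at h1
    have h2 : (#(B + B) : ℝ) ≤ (#(A + B) / #A : ℝ) ^ 2 * #A := by simpa using (NNRat.cast_le (K := ℝ)).2 h1
    exact h2.trans (by gcongr)
  · have h1 := pluennecke_ruzsa_inequality_nsmul_sub_nsmul_add hA B 1 1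
    rw [one_nsmul] at h1
    have h2 : (#(B - B) : ℝ) ≤ (#(A + B) / #A : ℝ) ^ 2 * #A := by simpa using (NNRat.cast_le (K := ℝ)).2 h1
    exact h2.trans (by gcongr)
  · have h1 := pluennecke_ruzsa_inequality_nsmul_sub_nsmul_add hA B 2 2
    rw [two_nsmul, ← sub_add_sub_comm] at h1
    have h2 : (#(B - B + (B - B)) : ℝ) ≤ (#(A + B) / #A : ℝ) ^ 4 * #A := by simpa using (NNRat.cast_le (K := ℝ)).2 h1
    exact h2.trans (by gcongr)

-- The first summand fixes the second, so each sum has at most `#A` representations. In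
-- `proposition4` this forces `1 ≤ K`.
open Finset in
lemma addEnergy_le_card_pow {G : Type*} [AddCommGroup G] [DecidableEq G] (A B : Finset G)
    (h : #B = #A) : addEnergy A B ≤ #A ^ 3 := by
  rw [addEnergy_eq_sum_card_filter]
  calc _ ≤ #(A ×ˢ B) • #A := by
        refine sum_le_card_nsmul _ _ _ fun p _ => ?_
        refine card_le_card_of_injOn Prod.fst (fun q hq => ?_) ?_
        · exact (mem_product.1 (mem_filter.1 hq).1).1
        · rintro ⟨a, b⟩ hp ⟨a', b'⟩ hq (rfl : a = a')
          have h1 := (mem_filter.1 hp).2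
          have h2 := (mem_filter.1 hq).2
          simp only at h1 h2
          rw [add_left_cancel (h1.trans h2.symm)]
    _ = _ := by rw [card_product, h, smul_eq_mul]; ring

open Finset in
/-- If `A` has large energy with each of its dilates by elements of `X`, then, relative to one of
these dilates, many others nearly preserve a large subset of `A`. -/
theorem exists_subset_almost_invariant {F : Type*} [Field F] [DecidableEq F] (A X : Finset F)
    {K κ : ℝ} (hK : 1 ≤ K) (hκ : κ = 6 * K) (hA : A.Nonempty) (hX : X.Nonempty)
    (hX0 : ∀ ξ ∈ X, ξ ≠ 0) (h : ∀ ξ ∈ X, (#A : ℝ) ^ 3 / K ≤ addEnergy A (ξ • A)) :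
    ∃ η ∈ X, ∃ B ⊆ A, ∃ Y ⊆ X, (#X : ℝ) ≤ 2 * κ ^ 4 * #Y ∧ (#A : ℝ) ≤ κ * #B ∧
      (#(B + B) : ℝ) ≤ κ ^ 12 * #A ∧ (#(B - B) : ℝ) ≤ κ ^ 12 * #A ∧
      (#(B - B + (B - B)) : ℝ) ≤ κ ^ 24 * #A ∧
      ∀ ξ ∈ Y, (#(B + (η⁻¹ * ξ) • B) : ℝ) ≤ κ ^ 27 * #A ∧
        (#(B - (η⁻¹ * ξ) • B) : ℝ) ≤ κ ^ 27 * #A ∧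
        ∃ t, (#A : ℝ) ≤ κ ^ 16 * (#{b ∈ B | η⁻¹ * ξ * b - t ∈ B} : ℝ) := by
  have hκ6 : 6 ≤ κ := by linarith
  have hκ0 : 0 < κ := by linarith
  set n : ℝ := (#A : ℝ) with hn
  have hn0 : 0 < n := Nat.cast_pos.2 hA.card_pos
  have hbsg : ∀ ξ ∈ X, ∃ P : Finset F × Finset F, P.1 ⊆ A ∧ P.2 ⊆ A ∧ n ≤ κ * #P.1 ∧
      n ≤ κ * #P.2 ∧ (#(P.1 + ξ • P.2) : ℝ) ≤ κ ^ 5 * n := by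
    intro ξ hξ
    obtain ⟨A', hA', B', hB', h1, h2, h3⟩ := balog_szemeredi_gowers A (ξ • A)
      (by linarith : 0 < K) hA (card_dilate (hX0 ξ hξ) A) (h ξ hξ)
    have e : ξ • (ξ⁻¹ • B') = B' := by
      rw [smul_smul, mul_inv_cancel₀ (hX0 ξ hξ), one_smul]
    rw [← hκ, div_le_iff₀ hκ0, mul_comm] at h1 h2
    refine ⟨(A', ξ⁻¹ • B'), hA', ?_, h1, ?_, ?_⟩
    · calc ξ⁻¹ • B' ⊆ ξ⁻¹ • (ξ • A) := smul_finset_subset_smul_finset hB'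
        _ = A := by rw [smul_smul, inv_mul_cancel₀ (hX0 ξ hξ), one_smul]
    · rwa [card_dilate (inv_ne_zero (hX0 ξ hξ))]
    · rw [e]
      refine h3.trans ?_
      rw [hκ, mul_pow]
      gcongr
      norm_num
  choose! P hPA hPB hPAn hPBn hPAB using hbsg
  -- Intersecting the products, not the components separately, keeps `#A' * #B'` large at the cost
  -- of only `2 * κ ^ 4`.
  obtain ⟨η, hη, hY⟩ := exists_popular_intersection X (fun ξ => (P ξ).1 ×ˢ (P ξ).2) (A ×ˢ A) hX
    (fun ξ hξ => product_subset_product (hPA ξ hξ) (hPB ξ hξ)) (δ := 1 / κ ^ 2) (by positivity)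
    (hA.product hA) (fun ξ hξ => by
      rw [card_product, card_product]
      push_cast
      rw [one_div_mul_eq_div, div_le_iff₀ (by positivity)]
      calc n * n ≤ κ * #(P ξ).1 * (κ * #(P ξ).2) := by
            gcongr
            · exact hPAn ξ hξ
            · exact hPBn ξ hξ
        _ = _ := by ring)
  set Y := {ξ ∈ X | (1 / κ ^ 2) ^ 2 / 2 * (#(A ×ˢ A) : ℝ) ≤
    #((P ξ).1 ×ˢ (P ξ).2 ∩ (P η).1 ×ˢ (P η).2)} with hYdef
  set B := (P η).2 with hB
  have hη0 := hX0 η hη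
  have hA'0 : (0 : ℝ) < #(P η).1 := by
    have := hPAn η hη
    by_contra! h0
    nlinarith
  have hA'n : (#(P η).1 : ℝ) ≤ n := Nat.cast_le.2 (card_le_card (hPA η hη))
  obtain ⟨hBB, hBB', hBB4⟩ := card_add_self_le_of_card_add_le (A := η⁻¹ • (P η).1) (B := B)
    (ρ := κ ^ 6) ((card_pos.1 (Nat.cast_pos.1 hA'0)).smul_finset) (by
      have e : η⁻¹ • (P η).1 + B = η⁻¹ • ((P η).1 + η • B) := by
        rw [smul_add, smul_smul, inv_mul_cancel₀ hη0, one_smul]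
      rw [e, card_dilate (inv_ne_zero hη0), card_dilate (inv_ne_zero hη0)]
      calc _ ≤ κ ^ 5 * n := hPAB η hη
        _ ≤ κ ^ 5 * (κ * #(P η).1) := by gcongr; exact hPAn η hη
        _ = _ := by ring)
  rw [card_dilate (inv_ne_zero hη0), ← pow_mul] at hBB hBB' hBB4
  have hBB2 : (#(B + B) : ℝ) ≤ κ ^ 12 * n := hBB.trans (by gcongr)
  refine ⟨η, hη, B, hPB η hη, Y, filter_subset _ _, ?_, hPBn η hη, hBB2,
    hBB'.trans (by gcongr), hBB4.trans (by gcongr), ?_⟩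
  · calc (#X : ℝ) = 2 * κ ^ 4 * ((1 / κ ^ 2) ^ 2 / 2 * #X) := by field_simp
      _ ≤ _ := by gcongr
  intro ξ hξ
  obtain ⟨hξX, hξ2⟩ := mem_filter.1 hξ
  have hξ0 := hX0 ξ hξX
  set A' := (P ξ).1 ∩ (P η).1 with hA'
  set B' := (P ξ).2 ∩ B with hB'
  have hcap : n ^ 2 ≤ 2 * κ ^ 4 * (#A' * #B' : ℝ) := by
    rw [product_inter_product, card_product, card_product] at hξ2
    push_cast at hξ2
    calc n ^ 2 = 2 * κ ^ 4 * ((1 / κ ^ 2) ^ 2 / 2 * (n * n)) := by field_simp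
      _ ≤ _ := by gcongr
  have hξB : (#(ξ • B + ξ • B') : ℝ) ≤ κ ^ 12 * n := by
    refine le_trans ?_ hBB2
    rw [← smul_add, card_dilate hξ0]
    exact Nat.cast_le.2 (card_le_card (add_subset_add_left inter_subset_right))
  have hξAB : (#(A' + ξ • B') : ℝ) ≤ κ ^ 5 * n :=
    le_trans (Nat.cast_le.2 (card_le_card (add_subset_add inter_subset_left
      (smul_finset_subset_smul_finset inter_subset_left)))) (hPAB ξ hξX)
  have hηAB : (#(A' + η • B) : ℝ) ≤ κ ^ 5 * n :=
    le_trans (Nat.cast_le.2 (card_le_card (add_subset_add_right inter_subset_right))) (hPAB η hη)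
  have hdil : η • (η⁻¹ * ξ) • B = ξ • B := by rw [smul_smul, mul_inv_cancel_left₀ hη0]
  have e1 : #(B + (η⁻¹ * ξ) • B) = #(ξ • B + η • B) := by
    rw [← card_dilate hη0 (B + _), smul_add, hdil, add_comm]
  have e2 : #(B - (η⁻¹ * ξ) • B) = #(ξ • B - η • B) := by
    rw [← card_dilate hη0 (B - _), sub_eq_add_neg, smul_add, smul_finset_neg, hdil,
      ← sub_eq_add_neg, ← card_neg, neg_sub]
  -- The path from `ξ • B` to `η • B` runs through `ξ • B'` and `A'`, costing `κ ^ 12`, `κ ^ 5`, `κ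
  -- ^ 5`; the density of `A' × B'` costs a further `κ ^ 5`.
  have hchain := card_add_sub_mul_le_chain (ξ • B) (ξ • B') A' (η • B)
  rw [← e1, ← e2, card_dilate hξ0] at hchain
  have hbound : ∀ S : ℕ, S * (#A' * #B') ≤ #(ξ • B + ξ • B') * #(ξ • B' + A') * #(A' + η • B) →
      (S : ℝ) ≤ κ ^ 27 * n := by
    intro S hS
    rw [add_comm _ A'] at hS
    have hS' : (S : ℝ) * (#A' * #B') ≤ κ ^ 12 * n * (κ ^ 5 * n) * (κ ^ 5 * n) := by
      calc (S : ℝ) * (#A' * #B')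
          ≤ #(ξ • B + ξ • B') * #(A' + ξ • B') * #(A' + η • B) := by exact_mod_cast hS
        _ ≤ _ := by gcongr
    refine le_of_mul_le_mul_right ?_ (by positivity : 0 < n ^ 2)
    calc (S : ℝ) * n ^ 2 ≤ S * (2 * κ ^ 4 * (#A' * #B')) := by gcongr
      _ = 2 * κ ^ 4 * (S * (#A' * #B')) := by ring
      _ ≤ κ * κ ^ 4 * (κ ^ 12 * n * (κ ^ 5 * n) * (κ ^ 5 * n)) := by gcongr; linarith
      _ = _ := by ring
  refine ⟨hbound _ hchain.1, hbound _ hchain.2, ?_⟩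
  obtain ⟨t, ht⟩ := exists_translate_dilate_inter (P η).1 A' B B' hξ0 hη0 inter_subset_right
    inter_subset_right
  refine ⟨t, ?_⟩
  set Q := {b ∈ B | η⁻¹ * ξ * b - t ∈ B}
  have ht' : (#A' * #B' * #B : ℝ) ≤ κ ^ 5 * n * (κ ^ 5 * n) * #Q := by
    calc (#A' * #B' * #B : ℝ) ≤ #(A' + ξ • B') * #((P η).1 + η • B) * #Q := by exact_mod_cast ht
      _ ≤ _ := by gcongr; exact hPAB η hη
  refine le_of_mul_le_mul_right ?_ (by positivity : 0 < n ^ 2)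
  calc n * n ^ 2 ≤ κ * #B * (2 * κ ^ 4 * (#A' * #B')) := by gcongr; exact hPBn η hη
    _ = 2 * κ ^ 5 * (#A' * #B' * #B) := by ring
    _ ≤ κ * κ ^ 5 * (κ ^ 5 * n * (κ ^ 5 * n) * #Q) := by gcongr; linarith
    _ = _ := by ring

/-! ### Assembly and exponents. -/

theorem proposition4 :
    ∃ (C : ℝ) (k : ℕ), 0 < C ∧
      ∀ (F : Type*) [Field F] [Fintype F] [DecidableEq F] (A X : Finset F) (K : ℝ),
        A.Nonempty → X.Nonempty → (0 : F) ∉ A → (0 : F) ∉ X → 0 < K →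
        (A.card : ℝ) ^ 3 * (X.card : ℝ) / K ≤ ∑ ξ ∈ X, (Finset.addEnergy A (ξ • A) : ℝ) →
        ∃ abar ∈ A, ∃ x₀ ∈ X, ∃ A₁ X' : Finset F,
          A₁ ⊆ A - {abar} ∧ X' ⊆ x₀⁻¹ • X ∧
          (K ^ 85)⁻¹ * (A.card : ℝ)
            ≤ C * Real.log (Fintype.card F : ℝ) ^ k * (A₁.card : ℝ) ∧
          (K ^ 5)⁻¹ * (X.card : ℝ)
            ≤ C * Real.log (Fintype.card F : ℝ) ^ k * (X'.card : ℝ) ∧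
          ((A₁ + X' * A₁).card : ℝ)
            ≤ C * Real.log (Fintype.card F : ℝ) ^ k * (K ^ 226 * (A₁.card : ℝ)) ∧
          ((A₁ + A₁).card : ℝ)
            ≤ C * Real.log (Fintype.card F : ℝ) ^ k * (K ^ 92 * (A₁.card : ℝ)) ∧
          ((A₁ - A₁).card : ℝ)
            ≤ C * Real.log (Fintype.card F : ℝ) ^ k * (K ^ 92 * (A₁.card : ℝ)) ∧
          (∀ x' ∈ X',
            ((A₁ + x' • A₁).card : ℝ)
              ≤ C * Real.log (Fintype.card F : ℝ) ^ k * (K ^ 126 * (A₁.card : ℝ)) ∧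
            ((A₁ - x' • A₁).card : ℝ)
              ≤ C * Real.log (Fintype.card F : ℝ) ^ k * (K ^ 126 * (A₁.card : ℝ))) ∧
          ((∀ ξ ∈ X, (A.card : ℝ) ^ 3 / K ≤ (Finset.addEnergy A (ξ • A) : ℝ)) →
            (K ^ 4)⁻¹ * (X.card : ℝ)
              ≤ C * Real.log (Fintype.card F : ℝ) ^ k * (X'.card : ℝ)) := by
  -- The power of the logarithm is 0. The constant comes from `κ = 12 * K` and the largest exponent,
  -- 226.
  refine ⟨12 ^ 226, 0, by positivity, ?_⟩
  intro F _ _ _ A X K hA hX _ hX0 hK h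
  simp only [pow_zero, mul_one]
  have hX0' : ∀ ξ ∈ X, ξ ≠ 0 := fun ξ hξ e => hX0 (e ▸ hξ)
  set n : ℝ := (A.card : ℝ) with hn
  have hn0 : 0 < n := Nat.cast_pos.2 hA.card_pos
  have hx0 : (0 : ℝ) < X.card := Nat.cast_pos.2 hX.card_pos
  have hE : ∀ ξ ∈ X, (Finset.addEnergy A (ξ • A) : ℝ) ≤ n ^ 3 := fun ξ hξ => by
    rw [hn]
    exact_mod_cast addEnergy_le_card_pow A (ξ • A) (card_dilate (hX0' ξ hξ) A)
  have hK1 : 1 ≤ K := by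
    have h1 : n ^ 3 * X.card / K ≤ n ^ 3 * X.card := by
      calc _ ≤ _ := h
        _ ≤ ∑ ξ ∈ X, n ^ 3 := Finset.sum_le_sum hE
        _ = _ := by simp; ring
    rw [div_le_iff₀ hK] at h1
    exact le_of_mul_le_mul_left (by linarith) (by positivity : 0 < n ^ 3 * X.card)
  -- Passing to dilates of at least half the average energy costs `2 * K` in the size of `X`; this
  -- is the fifth power of `K` in the bound for `X'`.
  set X₁ := {ξ ∈ X | n ^ 3 / (2 * K) ≤ (Finset.addEnergy A (ξ • A) : ℝ)} with hX₁
  have hX₁card : (X.card : ℝ) ≤ 2 * K * X₁.card := by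
    have h1 := card_mul_le_mul_card_filter_le X (fun ξ => (Finset.addEnergy A (ξ • A) : ℝ))
      (M := n ^ 3) (c := n ^ 3 / (2 * K)) (by positivity) hE
      (le_trans (le_of_eq (by field_simp)) h)
    rw [mul_div_assoc', div_le_iff₀ (by positivity)] at h1
    exact le_of_mul_le_mul_left (le_trans (le_of_eq (by ring)) (h1.trans (le_of_eq (by ring))))
      (by positivity : 0 < n ^ 3)
  have hX₁ne : X₁.Nonempty := by
    rw [Finset.nonempty_iff_ne_empty]
    intro e
    rw [e] at hX₁card
    simp at hX₁card
    exact hX.ne_empty hX₁card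
  set κ : ℝ := 6 * (2 * K) with hκ
  have hκK : κ = 12 * K := by rw [hκ]; ring
  have hκ1 : 12 ≤ κ := by linarith
  obtain ⟨η, hη, B, hBA, Y, hYX, hYcard, hBn, hBB, hBB', hBB4, hY⟩ :=
    exists_subset_almost_invariant A X₁ (K := 2 * K) (by linarith) hκ hA hX₁ne
      (fun ξ hξ => hX0' ξ (Finset.mem_filter.1 hξ).1) (fun ξ hξ => (Finset.mem_filter.1 hξ).2)
  have hηX : η ∈ X := (Finset.mem_filter.1 hη).1
  have hη0 := hX0' η hηX
  have hYX' : Y ⊆ X := hYX.trans (Finset.filter_subset _ _)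
  have hYne : Y.Nonempty := by
    rw [Finset.nonempty_iff_ne_empty]
    intro e
    rw [e] at hYcard
    simp at hYcard
    exact hX₁ne.ne_empty hYcard
  have hmem : ∀ y ∈ η⁻¹ • Y, ∃ ξ ∈ Y, η⁻¹ * ξ = y := fun y hy => Finset.mem_smul_finset.1 hy
  obtain ⟨c, hc, A₁, hA₁, hA₁n, hA₁X⟩ := exists_subset_card_add_mul_le B (η⁻¹ • Y) (κ := κ) (n := n)
    (by linarith) hn0 (Nat.cast_le.2 (Finset.card_le_card hBA)) hBn (hYne.smul_finset)
    (fun y hy => by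
      obtain ⟨ξ, hξ, rfl⟩ := hmem y hy
      exact mul_ne_zero (inv_ne_zero hη0) (hX0' ξ (hYX' hξ)))
    hBB' hBB4
    (fun y hy => by
      obtain ⟨ξ, hξ, rfl⟩ := hmem y hy
      exact (hY ξ hξ).1)
    (fun y hy => by
      obtain ⟨ξ, hξ, rfl⟩ := hmem y hy
      exact (hY ξ hξ).2.2)
  have hYc : (η⁻¹ • Y).card = Y.card := card_dilate (inv_ne_zero hη0) Y
  -- Replacing `n` by `#A₁` costs `κ ^ 30`, so the argument yields exponents 30, 203, 42 and 57;
  -- since `1 ≤ κ` they may be raised to the required ones.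
  have hconst : ∀ (a b : ℕ) (S : ℝ), a + 30 ≤ b → b ≤ 226 → S ≤ κ ^ a * n →
      S ≤ 12 ^ 226 * (K ^ b * A₁.card) := by
    intro a b S hab hb hS
    calc S ≤ κ ^ a * n := hS
      _ ≤ κ ^ a * (κ ^ 30 * A₁.card) := by gcongr
      _ = κ ^ (a + 30) * A₁.card := by ring
      _ ≤ κ ^ b * A₁.card := by gcongr; linarith
      _ = 12 ^ b * (K ^ b * A₁.card) := by rw [hκK]; ring
      _ ≤ _ := by gcongr; norm_num
  refine ⟨c, hBA hc, η, hηX, A₁, η⁻¹ • Y, hA₁.trans (Finset.sub_subset_sub_right hBA),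
    Finset.smul_finset_subset_smul_finset hYX', ?_, ?_, hconst 173 226 _ (by norm_num)
    (by norm_num) hA₁X, hconst 12 92 _ (by norm_num) (by norm_num) ?_,
    hconst 12 92 _ (by norm_num) (by norm_num) ?_, ?_, ?_⟩
  · rw [inv_mul_le_iff₀ (by positivity)]
    have := hconst 0 85 n (by norm_num) (by norm_num) (by simp)
    linarith
  · rw [inv_mul_le_iff₀ (by positivity), hYc]
    calc (X.card : ℝ) ≤ 2 * K * (2 * κ ^ 4 * Y.card) := by
          refine hX₁card.trans ?_
          gcongr
      _ = 4 * 12 ^ 4 * (K ^ 5 * Y.card) := by rw [hκK]; ring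
      _ ≤ 12 ^ 226 * (K ^ 5 * Y.card) := by gcongr; norm_num
      _ = _ := by ring
  · have := card_add_dilate_le_of_subset hA₁ 1
    rw [one_smul, one_smul] at this
    exact (Nat.cast_le.2 this).trans hBB
  · have := card_sub_dilate_le_of_subset hA₁ 1
    rw [one_smul, one_smul] at this
    exact (Nat.cast_le.2 this).trans hBB'
  · intro y hy
    obtain ⟨ξ, hξ, rfl⟩ := hmem y hy
    exact ⟨hconst 27 126 _ (by norm_num) (by norm_num)
        ((Nat.cast_le.2 (card_add_dilate_le_of_subset hA₁ _)).trans (hY ξ hξ).1),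
      hconst 27 126 _ (by norm_num) (by norm_num)
        ((Nat.cast_le.2 (card_sub_dilate_le_of_subset hA₁ _)).trans (hY ξ hξ).2.1)⟩
  · intro hall
    -- Under the uniform hypothesis nothing is discarded, which saves one factor of `K`.
    have e : X₁ = X := Finset.filter_true_of_mem fun ξ hξ => by
      refine le_trans ?_ (hall ξ hξ)
      gcongr
      linarith
    rw [inv_mul_le_iff₀ (by positivity), hYc]
    calc (X.card : ℝ) ≤ 2 * κ ^ 4 * Y.card := by rw [← e]; exact hYcard
      _ = 2 * 12 ^ 4 * (K ^ 4 * Y.card) := by rw [hκK]; ring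
      _ ≤ 12 ^ 226 * (K ^ 4 * Y.card) := by gcongr; linarith
      _ = _ := by ring
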